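/- A (rational polyhedral) fan in $\mathbb{R}^n$ is a finite nonempty collection $\mathcal{F}$ of convex cones, each generated by finitely many vectors of $\mathbb{Z}^n$ (cones may contain lines), that is closed under taking faces and in which any two cones intersect in a common face. Its dimension $\dim\mathcal{F}$ is the maximal dimension of a cone of $\mathcal{F}$, and $\operatorname{codim}\mathcal{F}=n-\dim\mathcal{F}$. The cones of dimension $\dim\mathcal{F}$ are its facets, those of dimension $\dim\mathcal{F}-1$ its ridges. Given real weights $w(\sigma)$ on the facets $\sigma$ of $\mathcal{F}$, the weighted fan is balanced if for every ridge $\tau$ $$\sum_{\sigma\supset\tau} w(\sigma)\,v_{\sigma/\tau}\in\operatorname{span}(\tau),$$ where the sum is over the facets $\sigma$ containing $\tau$, and $v_{\sigma/\tau}\in\sigma\cap\mathbb{Z}^n$ is a vector whose class generates $(\mathbb{Z}^n\cap\operatorname{span}\sigma)/(\mathbb{Z}^n\cap\operatorname{span}\tau)$. Let $\mathcal{F}_1,\dots,\mathcal{F}_k$ be balanced fans in $\mathbb{R}^n$ with positive weights. Then $$\operatorname{codim}(\mathcal{F}_1\cap\cdots\cap\mathcal{F}_k)\le \operatorname{codim}(\mathcal{F}_1)+\cdots+\operatorname{codim}(\mathcal{F}_k),$$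 where $\mathcal{F}_1\cap\cdots\cap\mathcal{F}_k$ is the intersection of the supports, which is the union of the cones $C_1\cap\cdots\cap C_k$ with $C_i\in\mathcal{F}_i$, and its codimension is $n$ minus the maximal dimension of these cones. -/

import Mathlib

/-- Convex cones in `ℝⁿ` that contain the origin (lineality spaces are allowed). -/
abbrev RealCone (n : ℕ) := PointedCone ℝ (Fin n → ℝ)

/-- The lattice point of `ℝⁿ` with the given integer coordinates. -/
def latticePoint {n : ℕ} (v : Fin n → ℤ) : Fin n → ℝ := fun j => (v j : ℝ)

namespace RealCone

/-- The linear span of a cone. -/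
def linearSpan {n : ℕ} (C : RealCone n) : Submodule ℝ (Fin n → ℝ) :=
  Submodule.span ℝ (C : Set (Fin n → ℝ))

/-- The dimension of a cone: the dimension of its linear span. -/
noncomputable def dim {n : ℕ} (C : RealCone n) : ℕ :=
  Module.finrank ℝ C.linearSpan

/-- A rational polyhedral cone: generated by finitely many lattice vectors. -/
def IsRational {n : ℕ} (C : RealCone n) : Prop :=
  ∃ s : Finset (Fin n → ℤ), C = PointedCone.hull ℝ (latticePoint '' (s : Set (Fin n → ℤ)))

theorem dim_le {n : ℕ} (C : RealCone n) : C.dim ≤ n := by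
  simpa [dim] using Submodule.finrank_le C.linearSpan

end RealCone

/-- The dimension of a collection of cones: the maximum of the dimensions of its members. -/
noncomputable def conesDim {n : ℕ} (S : Set (RealCone n)) : ℕ := sSup (RealCone.dim '' S)

/-- The codimension in `ℝⁿ` of a collection of cones. -/
noncomputable def conesCodim {n : ℕ} (S : Set (RealCone n)) : ℤ := (n : ℤ) - (conesDim S : ℤ)

/-- A rational polyhedral fan in `ℝⁿ`: a finite nonempty collection of rational polyhedral cones,
closed under taking faces, in which any two cones meet in a common face. It need be neither
complete nor pure, and its cones may contain lines. -/
structure RationalFan (n : ℕ) where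
  /-- The cones of the fan. -/
  cones : Finset (RealCone n)
  nonempty : cones.Nonempty
  isRational : ∀ C ∈ cones, RealCone.IsRational C
  face_mem : ∀ C ∈ cones, ∀ D : RealCone n, D.IsFaceOf C → D ∈ cones
  inter_face : ∀ C ∈ cones, ∀ D ∈ cones, (C ⊓ D).IsFaceOf C ∧ (C ⊓ D).IsFaceOf D

/-- `v` is a lattice normal vector of the cone `σ` relative to its facet `τ`: a lattice vector of
`σ` whose class generates the quotient of lattices `(ℤⁿ ∩ span σ) / (ℤⁿ ∩ span τ)`. For `τ` of
codimension one in `σ` this class is unique. -/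
def IsLatticeNormal {n : ℕ} (τ σ : RealCone n) (v : Fin n → ℤ) : Prop :=
  latticePoint v ∈ σ ∧
    ∀ u : Fin n → ℤ, latticePoint u ∈ σ.linearSpan →
      ∃ m : ℤ, latticePoint (u - m • v) ∈ τ.linearSpan

namespace RationalFan

/-- The support of a fan: the union of its cones. -/
def support {n : ℕ} (F : RationalFan n) : Set (Fin n → ℝ) :=
  ⋃ C ∈ F.cones, (C : Set (Fin n → ℝ))

/-- The dimension of a fan. -/
noncomputable def dim {n : ℕ} (F : RationalFan n) : ℕ := conesDim (F.cones : Set (RealCone n))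

/-- The codimension of a fan in `ℝⁿ`. -/
noncomputable def codim {n : ℕ} (F : RationalFan n) : ℤ := conesCodim (F.cones : Set (RealCone n))

open Classical in
/-- The facets of a fan: its cones of maximal dimension. -/
noncomputable def facets {n : ℕ} (F : RationalFan n) : Finset (RealCone n) :=
  F.cones.filter fun σ => σ.dim = F.dim

open Classical in
/-- The fan `F` with weight `w σ` on each facet `σ` is balanced: at every ridge `τ` (cone of
dimension `dim F - 1`) the weighted sum of the lattice normal vectors of the facets that contain
`τ` lies in the span of `τ`. The choice of the normal vectors does not matter, as they are unique
modulo the span of `τ`. -/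
def IsBalanced {n : ℕ} (F : RationalFan n) (w : RealCone n → ℝ) : Prop :=
  ∀ τ ∈ F.cones, τ.dim + 1 = F.dim →
    ∃ v : RealCone n → (Fin n → ℤ),
      (∀ σ ∈ F.facets, τ ≤ σ → IsLatticeNormal τ σ (v σ)) ∧
      ∑ σ ∈ F.facets.filter (fun σ => τ ≤ σ), w σ • latticePoint (v σ) ∈ τ.linearSpan

/-- The intersection of finitely many fans, as a collection of cones (the common refinement):
all intersections of one cone from each fan. For the empty family this is `{ℝⁿ}`. -/
def inter {n k : ℕ} (F : Fin k → RationalFan n) : Set (RealCone n) :=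
  {D | ∃ C : Fin k → RealCone n, (∀ i, C i ∈ (F i).cones) ∧ D = ⨅ i, C i}

/-- The cones of the intersection cover exactly the intersection of the supports. -/
theorem iUnion_inter {n k : ℕ} (F : Fin k → RationalFan n) :
    (⋃ D ∈ inter F, (D : Set (Fin n → ℝ))) = ⋂ i, (F i).support := by
  ext x
  simp only [inter, support, Set.mem_iUnion, Set.mem_iInter, Set.mem_ofPred_eq, SetLike.mem_coe,
    exists_prop]
  constructor
  · rintro ⟨D, ⟨C, hC, rfl⟩, hx⟩ i
    exact ⟨C i, hC i, (Submodule.mem_iInf _).1 hx i⟩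
  · intro h
    choose C hC hx using h
    exact ⟨_, ⟨C, hC, rfl⟩, (Submodule.mem_iInf _).2 hx⟩

end RationalFan

/-! The intersection of the supports is the part of the product of the supports that lies on the
diagonal of `(ℝⁿ)ᵏ`. Let `d = ∑ dim Fᵢ` and let `e` be the dimension of the intersection. A subspace
`K` of `ℝⁿ` of dimension at least `n - e`, transversal to the spans of all cones of the
intersection, has a diagonal image that meets the product only in `0`. It therefore suffices that
such a subspace of `(ℝⁿ)ᵏ` has codimension at least `d` (`finrank_add_sum_dim_le`): this gives `n -
e + d ≤ k * n`, which is the claim.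

That bound comes from two opposing facts about linear maps from `(ℝⁿ)ᵏ` to a space of dimension `d`.

Surjectivity (`facetImage_eq_univ`): a map that is nondegenerate on one product of facets sends the
product of the supports onto the target. The image of the nondegenerate products is closed. A
generic segment avoids the images of faces of codimension two. Where it crosses the image of a face
of codimension one, balancing and positivity of the weights provide a facet on the other side, so
the segment never leaves the image (`eventually_add_mem_facetImage`).

Perturbation (`exists_map_eq_top_notMem_image`): if the codimension were less than `d`, the quotient
map would give a map that is not onto and has no nonzero zero on the closed product. A small
perturbation makes it nondegenerate on a product of facets while its image of the product still
misses a point. -/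

open Filter Topology

universe u

/-! ### Closedness, relative interiors and faces of cones -/

namespace PointedCone

variable {E : Type u} [NormedAddCommGroup E] [NormedSpace ℝ E]

/-- **Carathéodory**: a cone generated by linearly dependent vectors is the union of the cones
obtained by omitting one generator. -/
theorem hull_eq_iUnion_erase [DecidableEq E] {s : Finset E}
    (hs : ¬ LinearIndepOn ℝ id (s : Set E)) :
    (hull ℝ (s : Set E) : Set E) = ⋃ a ∈ s, (hull ℝ ((s.erase a : Finset E) : Set E) : Set E) := by
  apply Set.Subset.antisymm
  · intro x hx
    obtain ⟨f, -, rfl⟩ := Submodule.mem_span_finset.1 hx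
    obtain ⟨g, hg, hg0⟩ : ∃ g : E → ℝ, ∑ e ∈ s, g e • e = 0 ∧ ∃ e ∈ s, 0 < g e := by
      rw [linearIndepOn_finset_iff] at hs
      push Not at hs
      obtain ⟨g, hg, i, hi, hne⟩ := hs
      rcases lt_or_gt_of_ne hne with h | h
      · exact ⟨-g, by simpa using hg, i, hi, by simpa using h⟩
      · exact ⟨g, by simpa using hg, i, hi, h⟩
    -- The least ratio `f e / g e` is the largest multiple of the relation `g` that can be
    -- subtracted with all coefficients staying nonnegative; it kills the coefficient of `i`.
    obtain ⟨i, hi, hmin⟩ := (s.filter fun e => 0 < g e).exists_min_image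
      (fun e => (f e : ℝ) / g e) (by obtain ⟨e, he, h⟩ := hg0; exact ⟨e, by simp [he, h]⟩)
    simp only [Finset.mem_filter] at hi hmin
    set t : ℝ := f i / g i with ht
    have ht0 : 0 ≤ t := div_nonneg (f i).2 hi.2.le
    have hnonneg : ∀ e ∈ s, 0 ≤ (f e : ℝ) - t * g e := by
      intro e he
      rcases lt_or_ge 0 (g e) with h | h
      · have := hmin e ⟨he, h⟩
        rw [le_div_iff₀ h] at this
        linarith
      · have := (f e).2
        have := mul_nonpos_of_nonneg_of_nonpos ht0 h
        linarith
    have hx : ∑ e ∈ s, f e • e = ∑ e ∈ s.erase i, ((f e : ℝ) - t * g e) • e := by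
      have h0 : ((f i : ℝ) - t * g i) • i = 0 := by
        rw [ht, div_mul_cancel₀ _ hi.2.ne', sub_self, zero_smul]
      rw [Finset.sum_erase (f := fun e => ((f e : ℝ) - t * g e) • e) s h0]
      simp only [sub_smul, Finset.sum_sub_distrib, mul_smul, ← Finset.smul_sum, hg, smul_zero,
        sub_zero]
      rfl
    simp only [Set.mem_iUnion]
    refine ⟨i, hi.1, ?_⟩
    rw [hx]
    exact Submodule.sum_mem _ fun e he => smul_mem _ (hnonneg e (Finset.mem_of_mem_erase he))
      (subset_hull (by exact_mod_cast he))
  · simp only [Set.iUnion_subset_iff]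
    intro a _
    exact Submodule.span_mono (by simp)

/-- A finitely generated cone in a finite-dimensional space is closed. -/
theorem isClosed_hull [FiniteDimensional ℝ E] (s : Finset E) :
    IsClosed (hull ℝ (s : Set E) : Set E) := by
  classical
  induction s using Finset.strongInduction with
  | H s ih =>
  by_cases hs : LinearIndepOn ℝ id (s : Set E)
  -- For independent generators the cone is the image of the closed orthant under an injective
  -- linear map, which is a closed embedding.
  · let L : (s → ℝ) →ₗ[ℝ] E := Fintype.linearCombination ℝ (fun e : s => (e : E))
    have hL : LinearMap.ker L = ⊥ :=
      LinearMap.ker_eq_bot.2 (linearIndependent_iff_injective_fintypeLinearCombination.1 hs)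
    have hcl := (LinearMap.isClosedEmbedding_of_injective hL).isClosedMap
      (Set.Ici 0) isClosed_Ici
    convert hcl using 1
    ext x
    constructor
    · intro hx
      obtain ⟨f, -, rfl⟩ := Submodule.mem_span_finset.1 hx
      refine ⟨fun e => f e, fun e => (f e).2, ?_⟩
      simp only [L, Fintype.linearCombination_apply]
      exact Finset.sum_coe_sort s (fun e => (f e : ℝ) • e)
    · rintro ⟨f, hf, rfl⟩
      simp only [L, Fintype.linearCombination_apply]
      exact Submodule.sum_mem _ fun e _ => smul_mem _ (hf e) (subset_hull e.2)
  · rw [hull_eq_iUnion_erase hs]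
    exact s.finite_toSet.isClosed_biUnion fun a ha => ih _ (Finset.erase_ssubset ha)

/-- The span of a cone has a basis of vectors in the cone. -/
theorem exists_basis_span [FiniteDimensional ℝ E] (C : PointedCone ℝ E) :
    ∃ (ι : Type u) (_ : Fintype ι) (b : Module.Basis ι ℝ (Submodule.span ℝ (C : Set E))),
      ∀ i, (b i : E) ∈ C := by
  obtain ⟨s, hsC, hspan, hli⟩ := exists_linearIndependent ℝ (C : Set E)
  have hs : s.Finite := hli.setFinite
  let b := (Module.Basis.span hli).map (LinearEquiv.ofEq _ (Submodule.span ℝ (C : Set E))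
    (by simpa using hspan))
  refine ⟨s, hs.fintype, b, fun i => ?_⟩
  have : (b i : E) = i := by
    simp only [b, Module.Basis.map_apply, LinearEquiv.coe_ofEq_apply]
    exact congrArg Subtype.val (Module.Basis.span_apply hli i)
  rw [this]
  exact hsC i.2

/-- A point of a cone that can be moved slightly against every vector of the cone is interior to
the cone relative to its span. -/
theorem eventually_add_mem [FiniteDimensional ℝ E] {C : PointedCone ℝ E} {q : E} (hq : q ∈ C)
    (h : ∀ x ∈ C, ∃ ε : ℝ, 0 < ε ∧ q - ε • x ∈ C) :
    ∀ᶠ z in 𝓝[(Submodule.span ℝ (C : Set E) : Set E)] 0, q + z ∈ C := by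
  obtain ⟨ι, _, b, hb⟩ := exists_basis_span C
  choose ε hε hmem using fun i => h (b i) (hb i)
  set N : ℝ := Fintype.card ι + 1 with hN
  have hN0 : 0 < N := by positivity
  have key : ∀ᶠ z : Submodule.span ℝ (C : Set E) in 𝓝 0, q + (z : E) ∈ C := by
    have : ∀ᶠ z : Submodule.span ℝ (C : Set E) in 𝓝 0, ∀ i, -(ε i) < N * b.coord i z := by
      rw [eventually_all]
      intro i
      have hc : Continuous fun z => N * b.coord i z :=
        continuous_const.mul (LinearMap.continuous_of_finiteDimensional _)
      exact (hc.tendsto 0).eventually (lt_mem_nhds (by simpa using hε i))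
    filter_upwards [this] with z hz
    -- An average of `N = card ι + 1` points of `C`: the point `q`, and one point displaced from `q`
    -- along each basis vector. The extra `1` keeps `N` positive when the basis is empty.
    have hsum : q + (z : E) = N⁻¹ • q + ∑ i, N⁻¹ • (q + (N * b.coord i z) • (b i : E)) := by
      have hz' : (z : E) = ∑ i, b.coord i z • (b i : E) := by
        conv_lhs => rw [← b.sum_repr z]
        simp [-Module.Basis.sum_repr]
      rw [hz']
      simp only [smul_add, Finset.sum_add_distrib, Finset.sum_const, Finset.card_univ, smul_smul,
        ← add_assoc, inv_mul_cancel_left₀ hN0.ne']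
      congr 1
      rw [← Nat.cast_smul_eq_nsmul ℝ, smul_smul, ← add_smul]
      have : N⁻¹ + (Fintype.card ι : ℝ) * N⁻¹ = 1 := by
        field_simp
        rw [hN]; ring
      rw [this, one_smul]
    rw [hsum]
    refine add_mem (smul_mem _ (inv_nonneg.2 hN0.le) hq) (Submodule.sum_mem _ fun i _ =>
      smul_mem _ (inv_nonneg.2 hN0.le) ?_)
    have : q + (N * b.coord i z) • (b i : E)
        = (q - ε i • (b i : E)) + (ε i + N * b.coord i z) • (b i : E) := by module
    rw [this]
    exact add_mem (hmem i) (smul_mem _ (by linarith [hz i]) (hb i))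
  rw [nhdsWithin_eq_map_subtype_coe (Submodule.zero_mem _)]
  exact key

/-- Every cone has a point that is interior relative to its span. -/
theorem exists_eventually_add_mem [FiniteDimensional ℝ E] (C : PointedCone ℝ E) :
    ∃ q ∈ C, ∀ᶠ z in 𝓝[(Submodule.span ℝ (C : Set E) : Set E)] 0, q + z ∈ C := by
  obtain ⟨ι, _, b, hb⟩ := exists_basis_span C
  -- All coordinates of this point equal `1`, so they stay nonnegative after a small multiple of any
  -- vector is subtracted.
  have hq : ∑ i, (b i : E) ∈ C := Submodule.sum_mem _ fun i _ => hb i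
  refine ⟨_, hq, eventually_add_mem hq fun x hx => ?_⟩
  let z : Submodule.span ℝ (C : Set E) := ⟨x, Submodule.subset_span hx⟩
  set N : ℝ := ∑ i, |b.coord i z| + 1 with hN
  have hle : ∀ i, |b.coord i z| ≤ N := fun i => by
    have := Finset.single_le_sum (f := fun i => |b.coord i z|) (fun i _ => abs_nonneg _)
      (Finset.mem_univ i)
    linarith
  have hN0 : 0 < N := by positivity
  refine ⟨N⁻¹, inv_pos.2 hN0, ?_⟩
  have hz' : x = ∑ i, b.coord i z • (b i : E) := by
    change (z : E) = _
    conv_lhs => rw [← b.sum_repr z]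
    simp [-Module.Basis.sum_repr]
  have : ∑ i, (b i : E) - N⁻¹ • x = ∑ i, (1 - N⁻¹ * b.coord i z) • (b i : E) := by
    rw [hz', Finset.smul_sum, ← Finset.sum_sub_distrib]
    exact Finset.sum_congr rfl fun i _ => by module
  rw [this]
  refine Submodule.sum_mem _ fun i _ => smul_mem _ ?_ (hb i)
  rw [sub_nonneg, inv_mul_le_iff₀ hN0, mul_one]
  exact (le_abs_self _).trans (hle i)

/-- Every point of a cone is relatively interior to some face of the cone. -/
theorem exists_face_eventually_add_mem [FiniteDimensional ℝ E] {C : PointedCone ℝ E} {q : E}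
    (hq : q ∈ C) :
    ∃ G : PointedCone ℝ E, G.IsFaceOf C ∧ q ∈ G ∧
      ∀ᶠ z in 𝓝[(Submodule.span ℝ (G : Set E) : Set E)] 0, q + z ∈ G := by
  have hmono : ∀ {x : E} {ε δ : ℝ}, 0 < ε → 0 ≤ δ → δ ≤ ε → q - ε • x ∈ C → q - δ • x ∈ C := by
    intro x ε δ hε hδ hle h
    have : q - δ • x = (1 - δ / ε) • q + (δ / ε) • (q - ε • x) := by
      rw [smul_sub, smul_smul, div_mul_cancel₀ _ hε.ne']; module
    rw [this]
    exact add_mem (smul_mem _ (sub_nonneg.2 ((div_le_one hε).2 hle)) hq)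
      (smul_mem _ (div_nonneg hδ hε.le) h)
  -- The smallest face containing `q`: the vectors of `C` against which `q` can be moved a little
  -- within `C`.
  let G : PointedCone ℝ E :=
    { carrier := {x | x ∈ C ∧ ∃ ε : ℝ, 0 < ε ∧ q - ε • x ∈ C}
      zero_mem' := ⟨zero_mem _, 1, one_pos, by simpa using hq⟩
      add_mem' := by
        rintro x y ⟨hx, ε, hε, hxε⟩ ⟨hy, δ, hδ, hyδ⟩
        refine ⟨add_mem hx hy, min ε δ / 2, by positivity, ?_⟩
        have h1 := hmono hε (lt_min hε hδ).le (min_le_left _ _) hxε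
        have h2 := hmono hδ (lt_min hε hδ).le (min_le_right _ _) hyδ
        have : q - (min ε δ / 2) • (x + y)
            = (1 / 2 : ℝ) • (q - min ε δ • x) + (1 / 2 : ℝ) • (q - min ε δ • y) := by module
        rw [this]
        exact add_mem (smul_mem _ (by norm_num) h1) (smul_mem _ (by norm_num) h2)
      smul_mem' := by
        rintro ⟨c, hc⟩ x ⟨hx, ε, hε, hxε⟩
        refine ⟨smul_mem _ hc hx, ε / (c + 1), by positivity, ?_⟩
        change q - (ε / (c + 1)) • (c • x) ∈ C
        rw [smul_smul]
        refine hmono hε (by positivity) ?_ hxε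
        rw [div_mul_eq_mul_div, div_le_iff₀ (by positivity)]
        nlinarith }
  have hG : G.IsFaceOf C := by
    refine ⟨fun x hx => hx.1, ?_⟩
    rintro x y a hx hy ha ⟨-, ε, hε, h⟩
    refine ⟨hx, ε * a, by positivity, ?_⟩
    have : q - (ε * a) • x = (q - ε • (a • x + y)) + ε • y := by module
    rw [this]
    exact add_mem h (smul_mem _ hε.le hy)
  have hqG : q ∈ G := ⟨hq, 1, one_pos, by simp⟩
  refine ⟨G, hG, hqG, eventually_add_mem hqG ?_⟩
  rintro x ⟨hx, ε, hε, h⟩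
  refine ⟨ε, hε, hG.mem_of_add_mem_left h (smul_mem _ hε.le hx) (by simpa using hqG)⟩

end PointedCone

/-! ### Transversal subspaces -/

/-- Finitely many subspaces of dimension at most `e` have a common transversal subspace of
codimension at most `e`. -/
theorem Submodule.exists_disjoint_of_finrank_le {V : Type*} [AddCommGroup V] [Module ℝ V]
    [FiniteDimensional ℝ V] {s : Set (Submodule ℝ V)} (hs : s.Finite) {e : ℕ}
    (he : ∀ W ∈ s, Module.finrank ℝ W ≤ e) :
    ∃ K : Submodule ℝ V, Module.finrank ℝ V ≤ Module.finrank ℝ K + e ∧ ∀ W ∈ s, Disjoint K W := by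
  classical
  suffices h : ∀ m : ℕ, m + e ≤ Module.finrank ℝ V →
      ∃ K : Submodule ℝ V, Module.finrank ℝ K = m ∧ ∀ W ∈ s, Disjoint K W by
    rcases le_total e (Module.finrank ℝ V) with hle | hle
    · obtain ⟨K, hK, hd⟩ := h (Module.finrank ℝ V - e) (by omega)
      exact ⟨K, by omega, hd⟩
    · exact ⟨⊥, by omega, fun W _ => disjoint_bot_left⟩
  intro m
  induction m with
  | zero => exact fun _ => ⟨⊥, by simp, fun W _ => disjoint_bot_left⟩
  | succ m ih =>
    intro hm
    obtain ⟨K, hK, hd⟩ := ih (by omega)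
    -- Enlarging `K` by a vector outside every `K ⊔ W` preserves disjointness. `K` itself is
    -- included so that the dimension grows even when `s` is empty.
    let t : Finset (Submodule ℝ V) := insert K (hs.toFinset.image fun W => K ⊔ W)
    have hlt : ∀ P ∈ t, Module.finrank ℝ P < Module.finrank ℝ V := by
      intro P hP
      simp only [t, Finset.mem_insert, Finset.mem_image, Set.Finite.mem_toFinset] at hP
      rcases hP with rfl | ⟨W, hW, rfl⟩
      · omega
      · have := Submodule.finrank_add_le_finrank_add_finrank K W
        have := he W hW
        omega
    have ht : ⊤ ∉ t := fun h => by simpa using hlt ⊤ h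
    obtain ⟨v, hv⟩ := (Set.ne_univ_iff_exists_notMem _).1
      (Subspace.biUnion_ne_univ_of_top_notMem ht)
    simp only [t, Set.mem_iUnion, not_exists, Finset.mem_insert, Finset.mem_image,
      Set.Finite.mem_toFinset, SetLike.mem_coe] at hv
    have hvK : v ∉ K := hv K (Or.inl rfl)
    have hv0 : v ≠ 0 := fun h => hvK (h ▸ K.zero_mem)
    refine ⟨K ⊔ Submodule.span ℝ {v}, ?_, fun W hW => ?_⟩
    · have := Submodule.finrank_sup_add_finrank_inf_eq K (Submodule.span ℝ {v})
      rw [(Submodule.disjoint_span_singleton' hv0).2 hvK |>.eq_bot, finrank_bot,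
        finrank_span_singleton hv0] at this
      omega
    · have hvW : v ∉ K ⊔ W := hv _ (Or.inr ⟨W, hW, rfl⟩)
      rw [Submodule.disjoint_def]
      intro x hx hxW
      obtain ⟨a, ha, b, hb, rfl⟩ := Submodule.mem_sup.1 hx
      obtain ⟨c, rfl⟩ := Submodule.mem_span_singleton.1 hb
      by_cases hc : c = 0
      · subst hc
        simp only [zero_smul, add_zero] at hxW ⊢
        exact (Submodule.disjoint_def.1 (hd W hW)) a ha hxW
      · exfalso
        apply hvW
        have : v = c⁻¹ • (-a) + c⁻¹ • (a + c • v) := by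
          rw [smul_add, smul_smul, inv_mul_cancel₀ hc]; module
        rw [this]
        exact add_mem (Submodule.smul_mem _ _ (Submodule.mem_sup_left (neg_mem ha)))
          (Submodule.smul_mem _ _ (Submodule.mem_sup_right hxW))

/-! ### General position, local images and perturbation of linear maps -/

section Normed

variable {V E : Type*} [NormedAddCommGroup V] [NormedSpace ℝ V]
  [NormedAddCommGroup E] [NormedSpace ℝ E] [FiniteDimensional ℝ E]

/-- A nonempty open set is not covered by finitely many proper subspaces. -/
theorem IsOpen.exists_notMem_submodules {U : Set E} (hU : IsOpen U) (hne : U.Nonempty)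
    {s : Set (Submodule ℝ E)} (hs : s.Finite) (htop : ⊤ ∉ s) : ∃ x ∈ U, ∀ W ∈ s, x ∉ W := by
  have : CompleteSpace E := FiniteDimensional.complete ℝ E
  have hd : Dense (⋂ W ∈ s, ((W : Set E)ᶜ)) := by
    refine dense_biInter_of_isOpen (fun W _ => ?_) hs.countable fun W hW => ?_
    · exact (Submodule.closed_of_finiteDimensional W).isOpen_compl
    · rw [← interior_eq_empty_iff_dense_compl]
      by_contra h
      exact htop (W.eq_top_of_nonempty_interior' (Set.nonempty_iff_ne_empty.2 h) ▸ hW)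
  obtain ⟨x, hx, hxU⟩ := hd.exists_mem_open hU hne
  exact ⟨x, hxU, by simpa using hx⟩

/-- If `f` maps the subspace `S` onto `E`, then it maps sets that contain a neighbourhood of `q` in
`q + S` to neighbourhoods of `f q`. -/
theorem LinearMap.eventually_add_mem_image (f : V →ₗ[ℝ] E) {S : Submodule ℝ V}
    (hS : S.map f = ⊤) {q : V} {B : Set V} (hB : ∀ᶠ z in 𝓝[(S : Set V)] 0, q + z ∈ B) :
    ∀ᶠ e in 𝓝 0, f q + e ∈ f '' B := by
  obtain ⟨g, hg⟩ := (f.domRestrict S).exists_rightInverse_of_surjective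
    (by rw [LinearMap.range_domRestrict, hS])
  have hcont : Continuous fun e => (g e : V) :=
    continuous_subtype_val.comp (LinearMap.continuous_of_finiteDimensional g)
  have ht : Tendsto (fun e => (g e : V)) (𝓝 0) (𝓝[(S : Set V)] 0) :=
    tendsto_nhdsWithin_iff.2
      ⟨by simpa using hcont.tendsto 0, Eventually.of_forall fun e => (g e).2⟩
  filter_upwards [ht.eventually hB] with e he
  refine ⟨_, he, ?_⟩
  have := LinearMap.congr_fun hg e
  simp only [LinearMap.comp_apply, LinearMap.domRestrict_apply, LinearMap.id_apply] at this
  rw [map_add, this]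

/-- If `f` maps the subspace `T` onto the hyperplane `ker ℓ` and `v` to its positive side, then it
maps sets that contain a neighbourhood of `q` in the half-space `q + T + ℝ≥0 v` to neighbourhoods
of `f q` in the half-space. -/
theorem LinearMap.eventually_add_mem_image_of_nonneg (f : V →ₗ[ℝ] E) {T : Submodule ℝ V}
    {ℓ : E →ₗ[ℝ] ℝ} (hT : T.map f = LinearMap.ker ℓ) {v : V} (hv : 0 < ℓ (f v)) {q : V} {B : Set V}
    (hB : ∀ᶠ z in 𝓝[(T : Set V)] 0, ∀ a : ℝ, 0 ≤ a → q + z + a • v ∈ B) :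
    ∀ᶠ e in 𝓝 0, 0 ≤ ℓ e → f q + e ∈ f '' B := by
  -- A linear right inverse of `Φ` is continuous, and its second coordinate has the sign of `ℓ`, so
  -- the half-space lifts to the half-space.
  let Φ : T × ℝ →ₗ[ℝ] E := (f.domRestrict T).coprod (LinearMap.toSpanSingleton ℝ E (f v))
  have hΦ : ∀ x, Φ x = f x.1 + x.2 • f v := fun x => rfl
  obtain ⟨g, hg⟩ := Φ.exists_rightInverse_of_surjective (by
    rw [LinearMap.range_eq_top]
    intro e
    have : e - (ℓ e / ℓ (f v)) • f v ∈ T.map f := by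
      rw [hT, LinearMap.mem_ker, map_sub, map_smul, smul_eq_mul, div_mul_cancel₀ _ hv.ne', sub_self]
    obtain ⟨t, ht, hte⟩ := this
    exact ⟨(⟨t, ht⟩, ℓ e / ℓ (f v)), by rw [hΦ]; simp [hte]⟩)
  have hge : ∀ e, f (g e).1 + (g e).2 • f v = e := fun e => LinearMap.congr_fun hg e
  have hℓ : ∀ e, ℓ e = (g e).2 * ℓ (f v) := fun e => by
    have h0 : ℓ (f (g e).1) = 0 := by
      rw [← LinearMap.mem_ker, ← hT]
      exact Submodule.mem_map_of_mem (g e).1.2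
    conv_lhs => rw [← hge e]
    rw [map_add, h0, map_smul, smul_eq_mul, zero_add]
  have hcont : Continuous fun e => ((g e).1 : V) :=
    continuous_subtype_val.comp (continuous_fst.comp (LinearMap.continuous_of_finiteDimensional g))
  have ht : Tendsto (fun e => ((g e).1 : V)) (𝓝 0) (𝓝[(T : Set V)] 0) :=
    tendsto_nhdsWithin_iff.2
      ⟨by simpa using hcont.tendsto 0, Eventually.of_forall fun e => (g e).1.2⟩
  filter_upwards [ht.eventually hB] with e he hpos
  rw [hℓ] at hpos
  refine ⟨_, he _ (nonneg_of_mul_nonneg_left hpos hv), ?_⟩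
  rw [map_add, map_add, map_smul, add_assoc, hge]

/-- A linear map that is not onto and vanishes on no nonzero point of a closed cone `X` can be
perturbed to one that maps a given subspace onto the target, but still not `X`. -/
theorem LinearMap.exists_map_eq_top_notMem_image [FiniteDimensional ℝ V] (p : V →ₗ[ℝ] E) (hp : LinearMap.range p ≠ ⊤)
    {X : Set V} (hX : IsClosed X) (hcone : ∀ x ∈ X, ∀ a : ℝ, 0 ≤ a → a • x ∈ X)
    (hker : ∀ x ∈ X, p x = 0 → x = 0) {S : Submodule ℝ V}
    (hS : Module.finrank ℝ S = Module.finrank ℝ E) :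
    ∃ f : V →ₗ[ℝ] E, S.map f = ⊤ ∧ ∃ y, y ∉ f '' X := by
  let φ : S ≃ₗ[ℝ] E := LinearEquiv.ofFinrankEq S E hS
  obtain ⟨h, hh⟩ := LinearMap.exists_extend (φ : S →ₗ[ℝ] E)
  have hhφ : ∀ x : S, h x = φ x := fun x => LinearMap.congr_fun hh x
  -- `r` is a projection onto the range of `p`; the point to be missed is taken in its kernel.
  obtain ⟨r, hr⟩ := LinearMap.exists_extend (LinearMap.id : LinearMap.range p →ₗ[ℝ] LinearMap.range p)
  have hrp : ∀ x, (r (p x) : E) = p x := fun x =>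
    congrArg Subtype.val (LinearMap.congr_fun hr ⟨p x, x, rfl⟩)
  obtain ⟨y, hy0, hry⟩ : ∃ y : E, y ≠ 0 ∧ r y = 0 := by
    obtain ⟨z, hz⟩ : ∃ z, z ∉ LinearMap.range p := by
      by_contra! hall
      exact hp (Submodule.eq_top_iff'.2 hall)
    refine ⟨z - r z, fun h0 => hz ?_, ?_⟩
    · rw [sub_eq_zero.1 h0]; exact (r z).2
    · rw [map_sub, sub_eq_zero]
      exact (LinearMap.congr_fun hr (r z)).symm
  obtain ⟨c, hc0, hc⟩ : ∃ c : ℝ, 0 < c ∧ ∀ x ∈ X, c * ‖x‖ ≤ ‖p x‖ := by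
    have hK : IsCompact (X ∩ Metric.sphere 0 1) := (isCompact_sphere 0 1).inter_left hX
    have hpc : Continuous fun x => ‖p x‖ := (LinearMap.continuous_of_finiteDimensional p).norm
    obtain ⟨c, hc0, hc⟩ : ∃ c : ℝ, 0 < c ∧ ∀ x ∈ X ∩ Metric.sphere 0 1, c ≤ ‖p x‖ := by
      rcases (X ∩ Metric.sphere 0 1).eq_empty_or_nonempty with he | hne
      · exact ⟨1, one_pos, by simp [he]⟩
      · obtain ⟨x, hx, hmin⟩ := hK.exists_isMinOn hne hpc.continuousOn
        refine ⟨‖p x‖, norm_pos_iff.2 fun h0 => ?_, fun z hz => hmin hz⟩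
        have := hker x hx.1 h0
        simpa [this] using hx.2
    refine ⟨c, hc0, fun x hx => ?_⟩
    rcases eq_or_ne x 0 with rfl | hx0
    · simp
    · have hn : 0 < ‖x‖ := norm_pos_iff.2 hx0
      have := hc (‖x‖⁻¹ • x) ⟨hcone x hx _ (inv_nonneg.2 hn.le), by
        simp [norm_smul, hn.ne']⟩
      rw [map_smul, norm_smul, norm_inv, norm_norm, inv_mul_eq_div, le_div_iff₀ hn] at this
      exact this
  let rh : V →L[ℝ] E := LinearMap.toContinuousLinearMap ((LinearMap.range p).subtype ∘ₗ r ∘ₗ h)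
  have hrh : ∀ x, rh x = r (h x) := fun x => rfl
  let A : Module.End ℝ S := (φ.symm : E →ₗ[ℝ] S) ∘ₗ p.domRestrict S
  -- The upper bound makes `ε • rh` weaker than the lower bound `c` of `p` on `X`; the eigenvalue
  -- condition makes `p + ε • h` injective on `S`, where `h` is the isomorphism `φ`.
  obtain ⟨ε, hε, hεA⟩ : ∃ ε ∈ Set.Ioo 0 (c / (‖rh‖ + 1)), ¬ A.HasEigenvalue (-ε) := by
    have hinf : (Set.Ioo 0 (c / (‖rh‖ + 1))).Infinite := Set.Ioo_infinite (by positivity)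
    obtain ⟨ε, h1, h2⟩ := hinf.exists_notMem_finite
      (A.finite_hasEigenvalue.preimage (f := fun x : ℝ => -x) (neg_injective.injOn))
    exact ⟨ε, h1, h2⟩
  refine ⟨p + ε • h, ?_, y, ?_⟩
  · rw [← LinearMap.range_domRestrict, LinearMap.range_eq_top]
    refine (LinearMap.injective_iff_surjective_of_finrank_eq_finrank hS).1 ?_
    rw [← LinearMap.ker_eq_bot, Submodule.eq_bot_iff]
    intro x hx
    by_contra hx0
    refine hεA (Module.End.hasEigenvalue_of_hasEigenvector (x := x) ⟨?_, hx0⟩)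
    rw [Module.End.mem_eigenspace_iff]
    have hx' : p x + ε • h x = 0 := hx
    change φ.symm (p x) = (-ε) • x
    rw [LinearEquiv.symm_apply_eq, map_smul, ← hhφ, neg_smul]
    exact eq_neg_of_add_eq_zero_left hx'
  · rintro ⟨x, hx, hxy⟩
    -- Projecting by `r` kills `y` and fixes `p x`; the two bounds then force `x = 0`, hence `y =
    -- 0`.
    have h1 : p x + ε • rh x = 0 := by
      have := congrArg (fun z => (r z : E)) hxy
      simpa [hry, hrp, hrh] using this
    have h2 : ‖p x‖ ≤ ε * (‖rh‖ * ‖x‖) := by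
      rw [eq_neg_of_add_eq_zero_left h1, norm_neg, norm_smul, Real.norm_of_nonneg hε.1.le]
      exact mul_le_mul_of_nonneg_left (rh.le_opNorm x) hε.1.le
    have h3 := hc x hx
    have h4 := hε.2
    rw [lt_div_iff₀ (by positivity)] at h4
    have hx0 : x = 0 := by
      by_contra hne
      have hn : 0 < ‖x‖ := norm_pos_iff.2 hne
      have := hε.1
      nlinarith [mul_pos this hn, mul_lt_mul_of_pos_right h4 hn]
    exact hy0 (by rw [← hxy, hx0, map_zero])

end Normed

/-! ### Rational cones, lattice normals and fans -/

/-- The dimension of a product of subspaces. -/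
theorem Submodule.finrank_pi_univ {ι : Type*} [Fintype ι] {V : ι → Type*}
    [∀ i, AddCommGroup (V i)] [∀ i, Module ℝ (V i)] [∀ i, FiniteDimensional ℝ (V i)]
    (p : ∀ i, Submodule ℝ (V i)) :
    Module.finrank ℝ (Submodule.pi Set.univ p) = ∑ i, Module.finrank ℝ (p i) := by
  let e : Submodule.pi Set.univ p ≃ₗ[ℝ] ∀ i, p i :=
    { toFun := fun x i => ⟨x.1 i, x.2 i trivial⟩
      invFun := fun x => ⟨fun i => x i, fun i _ => (x i).2⟩
      map_add' := fun _ _ => rfl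
      map_smul' := fun _ _ => rfl
      left_inv := fun _ => rfl
      right_inv := fun _ => rfl }
  rw [e.finrank_eq, Module.finrank_pi_fintype]

namespace RealCone

variable {n : ℕ}

theorem subset_linearSpan (C : RealCone n) : (C : Set (Fin n → ℝ)) ⊆ C.linearSpan :=
  Submodule.subset_span

theorem linearSpan_mono {C D : RealCone n} (h : C ≤ D) : C.linearSpan ≤ D.linearSpan :=
  Submodule.span_mono h

theorem dim_mono {C D : RealCone n} (h : C ≤ D) : C.dim ≤ D.dim :=
  Submodule.finrank_mono (linearSpan_mono h)

theorem linearSpan_eq_of_dim_eq {C D : RealCone n} (h : C ≤ D) (hd : C.dim = D.dim) :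
    C.linearSpan = D.linearSpan :=
  Submodule.eq_of_le_of_finrank_eq (linearSpan_mono h) hd

theorem IsRational.isClosed {C : RealCone n} (h : C.IsRational) :
    IsClosed (C : Set (Fin n → ℝ)) := by
  classical
  obtain ⟨s, rfl⟩ := h
  simpa using PointedCone.isClosed_hull (s.image latticePoint)

/-- The span of a rational cone is generated by lattice points of the cone. -/
theorem IsRational.linearSpan_le {C : RealCone n} (h : C.IsRational)
    {W : Submodule ℝ (Fin n → ℝ)} (hW : ∀ u, latticePoint u ∈ C → latticePoint u ∈ W) :
    C.linearSpan ≤ W := by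
  obtain ⟨s, hs⟩ := h
  have hsub : latticePoint '' (s : Set (Fin n → ℤ)) ⊆ W := by
    rintro _ ⟨u, hu, rfl⟩
    exact hW u (hs ▸ PointedCone.subset_hull ⟨u, hu, rfl⟩)
  refine Submodule.span_le.2 fun x hx => ?_
  rw [hs] at hx
  exact Submodule.span_le.2 hsub (PointedCone.hull_le_span _ _ hx)

end RealCone

theorem latticePoint_sub_smul {n : ℕ} (u v : Fin n → ℤ) (m : ℤ) :
    latticePoint (u - m • v) = latticePoint u - (m : ℝ) • latticePoint v := by
  ext j
  simp [latticePoint]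

/-- A lattice normal vector of `σ` relative to a face of codimension one completes the span of the
face to the span of `σ`. -/
theorem IsLatticeNormal.linearSpan_eq {n : ℕ} {τ σ : RealCone n} {v : Fin n → ℤ}
    (hv : IsLatticeNormal τ σ v) (hσ : σ.IsRational) (hle : τ ≤ σ) (hdim : τ.dim + 1 = σ.dim) :
    τ.linearSpan ⊔ Submodule.span ℝ {latticePoint v} = σ.linearSpan := by
  have hvτ : latticePoint v ∉ τ.linearSpan := by
    intro h
    -- If `v` lay in the span of `τ`, so would every lattice point of `σ`, and these span `σ`.
    have hsp : σ.linearSpan ≤ τ.linearSpan := hσ.linearSpan_le fun u hu => by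
      obtain ⟨m, hm⟩ := hv.2 u (σ.subset_linearSpan hu)
      rw [latticePoint_sub_smul] at hm
      simpa using add_mem hm (Submodule.smul_mem _ (m : ℝ) h)
    have := Submodule.finrank_mono hsp
    change σ.dim ≤ τ.dim at this
    omega
  have hv0 : latticePoint v ≠ 0 := fun h => hvτ (h ▸ Submodule.zero_mem _)
  refine Submodule.eq_of_le_of_finrank_eq (sup_le (RealCone.linearSpan_mono hle) ?_) ?_
  · rw [Submodule.span_singleton_le_iff_mem]
    exact σ.subset_linearSpan hv.1
  · have := Submodule.finrank_sup_add_finrank_inf_eq τ.linearSpan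
      (Submodule.span ℝ {latticePoint v})
    rw [(Submodule.disjoint_span_singleton' hv0).2 hvτ |>.eq_bot, finrank_bot,
      finrank_span_singleton hv0] at this
    exact this.trans hdim

theorem dim_le_conesDim {n : ℕ} {S : Set (RealCone n)} {C : RealCone n} (hC : C ∈ S) :
    C.dim ≤ conesDim S :=
  le_csSup ⟨n, by rintro _ ⟨C, -, rfl⟩; exact C.dim_le⟩ ⟨C, hC, rfl⟩

namespace RationalFan

variable {n : ℕ} (F : RationalFan n)

theorem mem_facets {σ : RealCone n} : σ ∈ F.facets ↔ σ ∈ F.cones ∧ σ.dim = F.dim := by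
  simp [facets]

theorem facets_nonempty : F.facets.Nonempty := by
  obtain ⟨σ, hσ, hd⟩ : F.dim ∈ RealCone.dim '' (F.cones : Set (RealCone n)) :=
    Nat.sSup_mem (F.nonempty.to_set.image _)
      ⟨n, by rintro _ ⟨C, -, rfl⟩; exact C.dim_le⟩
  exact ⟨σ, F.mem_facets.2 ⟨hσ, hd⟩⟩

theorem isClosed_support : IsClosed F.support :=
  F.cones.finite_toSet.isClosed_biUnion fun C hC => (F.isRational C hC).isClosed

theorem smul_mem_support {x : Fin n → ℝ} (hx : x ∈ F.support) {a : ℝ} (ha : 0 ≤ a) :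
    a • x ∈ F.support := by
  simp only [support, Set.mem_iUnion] at hx ⊢
  obtain ⟨C, hC, hx⟩ := hx
  exact ⟨C, hC, PointedCone.smul_mem _ ha hx⟩

end RationalFan

/-! ### Products of cones -/

/-- The product of a family of cones, as a set. -/
def coneProd {n k : ℕ} (C : Fin k → RealCone n) : Set (Fin k → Fin n → ℝ) :=
  {x | ∀ i, x i ∈ C i}

/-- The span of the product of a family of cones. -/
def coneProdSpan {n k : ℕ} (C : Fin k → RealCone n) : Submodule ℝ (Fin k → Fin n → ℝ) :=
  Submodule.pi Set.univ fun i => (C i).linearSpan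

section Products

variable {n k : ℕ}

theorem mem_coneProdSpan {C : Fin k → RealCone n} {x : Fin k → Fin n → ℝ} :
    x ∈ coneProdSpan C ↔ ∀ i, x i ∈ (C i).linearSpan := by
  simp [coneProdSpan, Submodule.mem_pi]

theorem finrank_coneProdSpan (C : Fin k → RealCone n) :
    Module.finrank ℝ (coneProdSpan C) = ∑ i, (C i).dim :=
  Submodule.finrank_pi_univ _

theorem eventually_add_mem_coneProd {C : Fin k → RealCone n} {q : Fin k → Fin n → ℝ}
    (h : ∀ i, ∀ᶠ z in 𝓝[((C i).linearSpan : Set (Fin n → ℝ))] 0, q i + z ∈ C i) :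
    ∀ᶠ z in 𝓝[(coneProdSpan C : Set (Fin k → Fin n → ℝ))] 0, q + z ∈ coneProd C := by
  simp only [coneProd, Set.mem_ofPred_eq, eventually_all]
  intro i
  have ht : Tendsto (fun z : Fin k → Fin n → ℝ => z i)
      (𝓝[(coneProdSpan C : Set (Fin k → Fin n → ℝ))] 0)
      (𝓝[((C i).linearSpan : Set (Fin n → ℝ))] 0) :=
    tendsto_nhdsWithin_iff.2
      ⟨((continuous_apply i).tendsto 0).mono_left nhdsWithin_le_nhds,
        eventually_nhdsWithin_of_forall fun z hz => mem_coneProdSpan.1 hz i⟩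
  exact ht.eventually (h i)

theorem isClosed_coneProd {C : Fin k → RealCone n} (hC : ∀ i, (C i).IsRational) :
    IsClosed (coneProd C) := by
  have : coneProd C = Set.pi Set.univ fun i => (C i : Set (Fin n → ℝ)) := by
    ext; simp [coneProd]
  rw [this]
  exact isClosed_set_pi fun i _ => (hC i).isClosed

theorem coneProdSpan_le_sup_span_single {σ C : Fin k → RealCone n} {j : Fin k} {v : Fin n → ℝ}
    (hj : (C j).linearSpan ⊔ Submodule.span ℝ {v} = (σ j).linearSpan)
    (hi : ∀ i ≠ j, (C i).linearSpan = (σ i).linearSpan) :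
    coneProdSpan σ ≤ coneProdSpan C ⊔ Submodule.span ℝ {(Pi.single j v : Fin k → Fin n → ℝ)} := by
  intro x hx
  rw [mem_coneProdSpan] at hx
  have hxj := hx j
  rw [← hj] at hxj
  obtain ⟨t, ht, b, hb, hxtb⟩ := Submodule.mem_sup.1 hxj
  obtain ⟨a, rfl⟩ := Submodule.mem_span_singleton.1 hb
  refine Submodule.mem_sup.2 ⟨x - a • (Pi.single j v : Fin k → Fin n → ℝ), ?_, _,
    Submodule.smul_mem _ a (Submodule.mem_span_singleton_self _), by simp⟩
  rw [mem_coneProdSpan]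
  intro i
  rcases eq_or_ne i j with rfl | hij
  · simpa [← hxtb] using ht
  · simpa [hij, hi i hij] using hx i

end Products

/-! ### Crossing a face of codimension one -/

namespace RationalFan

variable {n k : ℕ} {E : Type*} [NormedAddCommGroup E] [NormedSpace ℝ E]

/-- The union of the images under `f` of the products of facets whose span is mapped onto `E`. -/
def facetImage (F : Fin k → RationalFan n) (f : (Fin k → Fin n → ℝ) →ₗ[ℝ] E) : Set E :=
  {y | ∃ σ : Fin k → RealCone n, (∀ i, σ i ∈ (F i).facets) ∧ (coneProdSpan σ).map f = ⊤ ∧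
    y ∈ f '' coneProd σ}

/-- A family of numbers that are bounded by `d` and whose sum is at least `∑ d - 1` agrees with `d`
up to at most one place, where it is one less. -/
theorem eq_or_exists_of_sum_le {c d : Fin k → ℕ} (hcd : ∀ i, c i ≤ d i)
    (h : ∑ i, d i ≤ ∑ i, c i + 1) :
    (∀ i, c i = d i) ∨ ∃ j, c j + 1 = d j ∧ ∀ i ≠ j, c i = d i := by
  by_cases hall : ∀ i, c i = d i
  · exact Or.inl hall
  right
  push Not at hall
  obtain ⟨j, hj⟩ := hall
  have hsum : ∑ i, (d i - c i) ≤ 1 := by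
    rw [Finset.sum_tsub_distrib _ fun i _ => hcd i]
    omega
  have hj' : d j - c j ≤ 1 :=
    (Finset.single_le_sum (f := fun i => d i - c i) (fun _ _ => Nat.zero_le _)
      (Finset.mem_univ j)).trans hsum
  have := hcd j
  refine ⟨j, by omega, fun i hij => ?_⟩
  have hpair : ∑ l ∈ {i, j}, (d l - c l) ≤ 1 :=
    (Finset.sum_le_sum_of_subset (Finset.subset_univ _)).trans hsum
  rw [Finset.sum_pair hij] at hpair
  have := hcd i
  omega

variable [FiniteDimensional ℝ E]

/-- Balancing makes `facetImage` a neighbourhood of the image of every point of a nondegenerate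
product of facets that lies in no face of codimension two. -/
theorem eventually_add_mem_facetImage {F : Fin k → RationalFan n} {w : Fin k → RealCone n → ℝ}
    (hpos : ∀ i, ∀ σ ∈ (F i).facets, 0 < w i σ) (hbal : ∀ i, (F i).IsBalanced (w i))
    (f : (Fin k → Fin n → ℝ) →ₗ[ℝ] E) (hE : Module.finrank ℝ E = ∑ i, (F i).dim)
    {σ C : Fin k → RealCone n} (hσ : ∀ i, σ i ∈ (F i).facets) (hf : (coneProdSpan σ).map f = ⊤)
    (hC : ∀ i, (C i).IsFaceOf (σ i)) {q : Fin k → Fin n → ℝ}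
    (hq : ∀ i, ∀ᶠ z in 𝓝[((C i).linearSpan : Set (Fin n → ℝ))] 0, q i + z ∈ C i)
    (hdim : ∑ i, (F i).dim ≤ ∑ i, (C i).dim + 1) :
    ∀ᶠ e in 𝓝 0, f q + e ∈ facetImage F f := by
  classical
  have hσc := fun i => ((F i).mem_facets.1 (hσ i)).1
  have hσd := fun i => ((F i).mem_facets.1 (hσ i)).2
  have hCσ : coneProd C ⊆ coneProd σ := fun x hx i => (hC i).le (hx i)
  have hqC := eventually_add_mem_coneProd hq
  rcases eq_or_exists_of_sum_le
      (fun i => (RealCone.dim_mono (hC i).le).trans_eq (hσd i)) hdim with hall | ⟨j, hj, hi⟩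
  · have hspan : coneProdSpan C = coneProdSpan σ := by
      unfold coneProdSpan
      congr 1
      funext i
      exact RealCone.linearSpan_eq_of_dim_eq (hC i).le ((hall i).trans (hσd i).symm)
    rw [hspan] at hqC
    filter_upwards [f.eventually_add_mem_image hf hqC] with e he
    exact ⟨σ, hσ, hf, Set.image_mono hCσ he⟩
  have hspan : ∀ i ≠ j, (C i).linearSpan = (σ i).linearSpan := fun i hij =>
    RealCone.linearSpan_eq_of_dim_eq (hC i).le ((hi i hij).trans (hσd i).symm)
  have hCj : C j ∈ (F j).cones := (F j).face_mem _ (hσc j) _ (hC j)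
  obtain ⟨v, hv, hsum⟩ := hbal j (C j) hCj hj
  let s : RealCone n → (Fin k → Fin n → ℝ) := fun ρ => Pi.single j (latticePoint (v ρ))
  set T := coneProdSpan C with hT
  have hsup : ∀ ρ ∈ (F j).facets, C j ≤ ρ →
      (C j).linearSpan ⊔ Submodule.span ℝ {latticePoint (v ρ)} = ρ.linearSpan := fun ρ hρ hle =>
    (hv ρ hρ hle).linearSpan_eq ((F j).isRational ρ ((F j).mem_facets.1 hρ).1) hle
      (hj.trans ((F j).mem_facets.1 hρ).2.symm)
  have htop : T.map f ⊔ Submodule.span ℝ {f (s (σ j))} = ⊤ := by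
    rw [eq_top_iff, ← hf]
    refine (Submodule.map_mono
      (coneProdSpan_le_sup_span_single (hsup _ (hσ j) (hC j).le) hspan)).trans_eq ?_
    rw [Submodule.map_sup, Submodule.map_span, Set.image_singleton]
  have hlt : T.map f < ⊤ := by
    refine lt_top_iff_ne_top.2 fun h => ?_
    have h1 := Submodule.finrank_map_le f T
    rw [h, finrank_top, hE, hT, finrank_coneProdSpan] at h1
    have h2 : ∑ i, (C i).dim < ∑ i, (F i).dim := Finset.sum_lt_sum
      (fun i _ => (RealCone.dim_mono (hC i).le).trans_eq (hσd i)) ⟨j, Finset.mem_univ j, by omega⟩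
    omega
  -- The image of the span of `C` is a hyperplane; `ℓ` is its equation, positive on the side of `σ
  -- j`.
  obtain ⟨ℓ, hTℓ, hℓpos⟩ : ∃ ℓ : E →ₗ[ℝ] ℝ, T.map f ≤ LinearMap.ker ℓ ∧ 0 < ℓ (f (s (σ j))) := by
    obtain ⟨ℓ, hℓ0, hle⟩ := Submodule.exists_le_ker_of_lt_top _ hlt
    have hne : ℓ (f (s (σ j))) ≠ 0 := by
      intro h0
      apply hℓ0
      rw [← LinearMap.ker_eq_top, eq_top_iff, ← htop]
      exact sup_le hle (by rw [Submodule.span_singleton_le_iff_mem]; exact h0)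
    rcases lt_or_gt_of_ne hne with h | h
    · exact ⟨-ℓ, fun x hx => by simpa using hle hx, by simpa using h⟩
    · exact ⟨ℓ, hle, h⟩
  have hker : T.map f = LinearMap.ker ℓ := by
    refine le_antisymm hTℓ fun e he => ?_
    obtain ⟨t, ht, b, hb, rfl⟩ := Submodule.mem_sup.1 (htop ▸ Submodule.mem_top : e ∈ _)
    obtain ⟨a, rfl⟩ := Submodule.mem_span_singleton.1 hb
    have h0 : ℓ t = 0 := hTℓ ht
    have h1 : a * ℓ (f (s (σ j))) = 0 := by simpa [h0] using he
    rcases mul_eq_zero.1 h1 with rfl | h2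
    · simpa using ht
    · exact absurd h2 hℓpos.ne'
  have hsum0 : ∑ ρ ∈ (F j).facets.filter (fun ρ => C j ≤ ρ), w j ρ * ℓ (f (s ρ)) = 0 := by
    have hmem : (Pi.single j (∑ ρ ∈ (F j).facets.filter (fun ρ => C j ≤ ρ),
        w j ρ • latticePoint (v ρ)) : Fin k → Fin n → ℝ) ∈ T := by
      rw [hT, mem_coneProdSpan]
      intro i
      rcases eq_or_ne i j with rfl | hij
      · simpa using hsum
      · simp [hij]
    have h0 := hTℓ (Submodule.mem_map_of_mem (f := f) hmem)
    rw [LinearMap.mem_ker] at h0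
    have hs : (Pi.single j (∑ ρ ∈ (F j).facets.filter (fun ρ => C j ≤ ρ),
        w j ρ • latticePoint (v ρ)) : Fin k → Fin n → ℝ)
        = ∑ ρ ∈ (F j).facets.filter (fun ρ => C j ≤ ρ), w j ρ • s ρ := by
      have := map_sum (LinearMap.single ℝ (fun _ : Fin k => Fin n → ℝ) j)
        (fun ρ => w j ρ • latticePoint (v ρ)) ((F j).facets.filter (fun ρ => C j ≤ ρ))
      simp only [map_smul] at this
      exact this
    rw [hs] at h0
    simpa using h0
  -- The balancing sum vanishes under `ℓ`, has positive weights and a positive term at `σ j`, so it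
  -- has a negative term as well.
  obtain ⟨ρ, hρ, hρle, hρneg⟩ : ∃ ρ ∈ (F j).facets, C j ≤ ρ ∧ ℓ (f (s ρ)) < 0 := by
    by_contra! hall
    refine absurd hsum0 (Finset.sum_pos' (fun ρ hρ => ?_) ⟨σ j, ?_, ?_⟩).ne'
    · rw [Finset.mem_filter] at hρ
      exact mul_nonneg (hpos j ρ hρ.1).le (hall ρ hρ.1 hρ.2)
    · exact Finset.mem_filter.2 ⟨hσ j, (hC j).le⟩
    · exact mul_pos (hpos j _ (hσ j)) hℓpos
  let σ' := Function.update σ j ρ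
  have hσ' : ∀ i, σ' i ∈ (F i).facets := by
    intro i
    rcases eq_or_ne i j with rfl | hij
    · simpa [σ'] using hρ
    · simpa [σ', hij] using hσ i
  have hf' : (coneProdSpan σ').map f = ⊤ := by
    have hTle : T ≤ coneProdSpan σ' := by
      intro x hx
      rw [hT, mem_coneProdSpan] at hx
      rw [mem_coneProdSpan]
      intro i
      rcases eq_or_ne i j with rfl | hij
      · simpa [σ'] using RealCone.linearSpan_mono hρle (hx i)
      · simpa [σ', hij, ← hspan i hij] using hx i
    have hsρ : s ρ ∈ coneProdSpan σ' := by
      rw [mem_coneProdSpan]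
      intro i
      rcases eq_or_ne i j with rfl | hij
      · simpa [σ', s] using ρ.subset_linearSpan (hv ρ hρ hρle).1
      · simp [s, hij]
    rw [eq_top_iff]
    intro e _
    have h1 : e - (ℓ e / ℓ (f (s ρ))) • f (s ρ) ∈ T.map f := by
      rw [hker, LinearMap.mem_ker, map_sub, map_smul, smul_eq_mul, div_mul_cancel₀ _ hρneg.ne,
        sub_self]
    have h2 := Submodule.map_mono (f := f) hTle h1
    have h3 := Submodule.smul_mem _ (ℓ e / ℓ (f (s ρ))) (Submodule.mem_map_of_mem (f := f) hsρ)
    simpa using add_mem h2 h3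
  have hhalf : ∀ (σ₁ : Fin k → RealCone n), (∀ i, C i ≤ σ₁ i) →
      latticePoint (v (σ₁ j)) ∈ σ₁ j →
      ∀ᶠ z in 𝓝[(T : Set (Fin k → Fin n → ℝ))] 0, ∀ a : ℝ, 0 ≤ a →
        q + z + a • s (σ₁ j) ∈ coneProd σ₁ := by
    intro σ₁ hle hmem
    filter_upwards [hqC] with z hz a ha i
    rcases eq_or_ne i j with rfl | hij
    · simpa [s] using add_mem (hle i (hz i)) (PointedCone.smul_mem _ ha hmem)
    · simpa [s, hij] using hle i (hz i)
  have hplus := f.eventually_add_mem_image_of_nonneg hker hℓpos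
    (hhalf σ (fun i => (hC i).le) (hv _ (hσ j) (hC j).le).1)
  have hσ'j : σ' j = ρ := by simp [σ']
  have hminus := f.eventually_add_mem_image_of_nonneg (ℓ := -ℓ) (T := T) (v := s (σ' j)) (q := q)
    (B := coneProd σ')
    (by rw [hker]; ext; simp) (by rw [hσ'j]; simpa using hρneg)
    (hhalf σ' (fun i => by
      rcases eq_or_ne i j with rfl | hij
      · simpa [σ'] using hρle
      · simpa [σ', hij] using (hC i).le) (by rw [hσ'j]; exact (hv _ hρ hρle).1))
  filter_upwards [hplus, hminus] with e h1 h2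
  rcases le_total 0 (ℓ e) with h | h
  · exact ⟨σ, hσ, hf, h1 h⟩
  · exact ⟨σ', hσ', hf', h2 (by simpa using h)⟩

end RationalFan

/-! ### Surjectivity on products of balanced fans -/

namespace RationalFan

variable {n k : ℕ} {E : Type*} [NormedAddCommGroup E] [NormedSpace ℝ E] [FiniteDimensional ℝ E]

/-- By the dimension count, a map that is onto on the span of a product of facets is injective
there, hence a closed embedding of that span. -/
theorem isClosed_facetImage (F : Fin k → RationalFan n) (f : (Fin k → Fin n → ℝ) →ₗ[ℝ] E)
    (hE : Module.finrank ℝ E = ∑ i, (F i).dim) : IsClosed (facetImage F f) := by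
  have hU : facetImage F f = ⋃ σ ∈ {σ : Fin k → RealCone n | (∀ i, σ i ∈ (F i).facets) ∧
      (coneProdSpan σ).map f = ⊤}, f '' coneProd σ := by
    ext y
    simp [facetImage, and_assoc]
  rw [hU]
  refine Set.Finite.isClosed_biUnion
    ((Set.Finite.pi' fun i => (F i).facets.finite_toSet).subset fun σ hσ i => hσ.1 i) ?_
  rintro σ ⟨hσ, hf⟩
  set S := coneProdSpan σ with hS
  have hfin : Module.finrank ℝ S = Module.finrank ℝ E := by
    rw [hS, finrank_coneProdSpan, hE]
    exact Finset.sum_congr rfl fun i _ => ((F i).mem_facets.1 (hσ i)).2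
  have hinj : Function.Injective (f.domRestrict S) :=
    (LinearMap.injective_iff_surjective_of_finrank_eq_finrank hfin).2
      (by rw [← LinearMap.range_eq_top, LinearMap.range_domRestrict, hf])
  have hcl : IsClosed ((fun x : S => (x : Fin k → Fin n → ℝ)) ⁻¹' coneProd σ) :=
    (isClosed_coneProd fun i => (F i).isRational _ ((F i).mem_facets.1 (hσ i)).1).preimage
      continuous_subtype_val
  convert (LinearMap.isClosedEmbedding_of_injective (LinearMap.ker_eq_bot.2 hinj)).isClosedMap _ hcl
    using 1
  ext y
  constructor
  · rintro ⟨x, hx, rfl⟩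
    exact ⟨⟨x, mem_coneProdSpan.2 fun i => (σ i).subset_linearSpan (hx i)⟩, hx, rfl⟩
  · rintro ⟨x, hx, rfl⟩
    exact ⟨x, hx, rfl⟩

/-- A linear map from the product of positively weighted balanced fans to a space of the same
dimension is onto as soon as it is nondegenerate on some product of facets. -/
theorem facetImage_eq_univ {F : Fin k → RationalFan n} {w : Fin k → RealCone n → ℝ}
    (hpos : ∀ i, ∀ σ ∈ (F i).facets, 0 < w i σ) (hbal : ∀ i, (F i).IsBalanced (w i))
    (f : (Fin k → Fin n → ℝ) →ₗ[ℝ] E) (hE : Module.finrank ℝ E = ∑ i, (F i).dim)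
    {σ : Fin k → RealCone n} (hσ : ∀ i, σ i ∈ (F i).facets) (hf : (coneProdSpan σ).map f = ⊤) :
    facetImage F f = Set.univ := by
  rw [Set.eq_univ_iff_forall]
  intro y
  by_contra hy
  -- For `C` of codimension at least two, `L C` has dimension at most `d - 2 + 1`, so it is proper.
  -- A start point outside all `L C` makes the segment to `y` avoid the images of these faces,
  -- except possibly at `y`.
  let L : (Fin k → RealCone n) → Submodule ℝ E := fun C =>
    (coneProdSpan C).map f ⊔ Submodule.span ℝ {y}
  let Q : Set (Fin k → RealCone n) :=
    {C | (∀ i, C i ∈ (F i).cones) ∧ ∑ i, (C i).dim + 2 ≤ ∑ i, (F i).dim}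
  have hQ : Q.Finite :=
    (Set.Finite.pi' fun i => (F i).cones.finite_toSet).subset fun C hC i => hC.1 i
  obtain ⟨x₀, hx₀, hgen⟩ : ∃ x₀ ∈ facetImage F f, ∀ C ∈ Q, x₀ ∉ L C := by
    choose q hq hqmem using fun i => (σ i).exists_eventually_add_mem
    have hev := f.eventually_add_mem_image hf (eventually_add_mem_coneProd hqmem)
    obtain ⟨O, hO, hOo, hO0⟩ := eventually_nhds_iff.1 hev
    have htop : ⊤ ∉ L '' Q := by
      rintro ⟨C, hC, htop⟩
      have h1 := Submodule.finrank_add_le_finrank_add_finrank ((coneProdSpan C).map f)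
        (Submodule.span ℝ {y})
      have h2 := Submodule.finrank_map_le f (coneProdSpan C)
      have h3 : Module.finrank ℝ (Submodule.span ℝ {y}) ≤ 1 := by
        simpa using finrank_span_le_card (R := ℝ) ({y} : Set E)
      have h4 := hC.2
      change L C = ⊤ at htop
      rw [finrank_coneProdSpan] at h2
      change Module.finrank ℝ (L C) ≤ _ at h1
      rw [htop, finrank_top, hE] at h1
      omega
    obtain ⟨x, hx, hxL⟩ := (hOo.preimage (continuous_sub_right (f q))).exists_notMem_submodules
      ⟨f q, by simpa using hO0⟩ (hQ.image L) htop
    refine ⟨x, ⟨σ, hσ, hf, by simpa using hO _ hx⟩, fun C hC => hxL _ ⟨C, hC, rfl⟩⟩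
  let p : ℝ → E := fun t => x₀ + t • (y - x₀)
  have hp : Continuous p := by fun_prop
  have hK : IsCompact (Set.Icc (0 : ℝ) 1 ∩ p ⁻¹' facetImage F f) :=
    isCompact_Icc.inter_right ((isClosed_facetImage F f hE).preimage hp)
  -- The last point of the segment that lies in the closed image.
  obtain ⟨t, ⟨⟨ht0, ht1⟩, htU⟩, hmax⟩ := hK.exists_isGreatest
    ⟨0, ⟨le_rfl, zero_le_one⟩, by simpa [p] using hx₀⟩
  have ht1' : t < 1 := by
    refine lt_of_le_of_ne ht1 ?_
    rintro rfl
    exact hy (by simpa [p] using htU)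
  obtain ⟨ρ, hρ, hρf, q, hq, hqt⟩ := htU
  have hface : ∀ i, ∃ G : RealCone n, G.IsFaceOf (ρ i) ∧ q i ∈ G ∧
      ∀ᶠ z in 𝓝[(G.linearSpan : Set (Fin n → ℝ))] 0, q i + z ∈ G := fun i =>
    PointedCone.exists_face_eventually_add_mem (hq i)
  choose C hC hqC hCmem using hface
  have hdim : ∑ i, (F i).dim ≤ ∑ i, (C i).dim + 1 := by
    by_contra! hlt
    refine hgen C ⟨fun i => (F i).face_mem _ ((F i).mem_facets.1 (hρ i)).1 _ (hC i), hlt⟩ ?_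
    have h1 : p t ∈ (coneProdSpan C).map f :=
      ⟨q, mem_coneProdSpan.2 fun i => (C i).subset_linearSpan (hqC i), hqt⟩
    have h2 : x₀ = (1 - t)⁻¹ • p t + (1 - t)⁻¹ • (-t) • y := by
      have h3 : (1 - t) ≠ 0 := by linarith
      rw [← smul_add]
      have : p t + (-t) • y = (1 - t) • x₀ := by simp only [p]; module
      rw [this, smul_smul, inv_mul_cancel₀ h3, one_smul]
    rw [h2]
    exact add_mem (Submodule.smul_mem _ _ (Submodule.mem_sup_left h1))
      (Submodule.smul_mem _ _ (Submodule.smul_mem _ _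
        (Submodule.mem_sup_right (Submodule.mem_span_singleton_self y))))
  have hev := eventually_add_mem_facetImage hpos hbal f hE hρ hρf hC hCmem hdim
  have htend : Tendsto (fun u => p u - p t) (𝓝 t) (𝓝 0) := by
    have := (hp.sub continuous_const).tendsto (f := fun u => p u - p t) t
    simpa using this
  have hev' : ∀ᶠ u in 𝓝[>] t, p u ∈ facetImage F f := by
    filter_upwards [(htend.eventually hev).filter_mono nhdsWithin_le_nhds] with u hu
    simpa [hqt] using hu
  obtain ⟨u, hu, hut⟩ := (hev'.and (Ioo_mem_nhdsGT ht1')).exists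
  exact absurd (hmax ⟨⟨ht0.trans hut.1.le, hut.2.le⟩, hu⟩) (not_le.2 hut.1)

/-- A subspace that meets the product of positively weighted balanced fans only in the origin has
codimension at least the dimension of the product. -/
theorem finrank_add_sum_dim_le {F : Fin k → RationalFan n} {w : Fin k → RealCone n → ℝ}
    (hpos : ∀ i, ∀ σ ∈ (F i).facets, 0 < w i σ) (hbal : ∀ i, (F i).IsBalanced (w i))
    {K : Submodule ℝ (Fin k → Fin n → ℝ)} (hK : ∀ x ∈ K, (∀ i, x i ∈ (F i).support) → x = 0) :
    Module.finrank ℝ K + ∑ i, (F i).dim ≤ k * n := by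
  by_contra! hlt
  have hV : Module.finrank ℝ (Fin k → Fin n → ℝ) = k * n := by
    simp [Module.finrank_pi_fintype]
  have hquot := K.finrank_quotient_add_finrank
  rw [hV] at hquot
  have hle : Module.finrank ℝ ((Fin k → Fin n → ℝ) ⧸ K)
      < Module.finrank ℝ (Fin (∑ i, (F i).dim) → ℝ) := by
    rw [Module.finrank_fin_fun]; omega
  -- The quotient by `K` embeds in `ℝᵈ` as a proper subspace, so the composite has kernel `K` and is
  -- not onto.
  obtain ⟨g, hg⟩ := finrank_le_iff_exists_linearMap.1 hle.le
  choose σ hσ using fun i => (F i).facets_nonempty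
  obtain ⟨f, hf, y, hy⟩ := (g ∘ₗ K.mkQ).exists_map_eq_top_notMem_image
    (X := Set.pi Set.univ fun i => (F i).support) (S := coneProdSpan σ)
    (fun h => by
      have h1 := LinearMap.finrank_range_le g
      have h2 : LinearMap.range g = ⊤ := by
        rw [eq_top_iff, ← h]; exact LinearMap.range_comp_le_range _ _
      rw [h2, finrank_top] at h1
      omega)
    (isClosed_set_pi fun i _ => (F i).isClosed_support)
    (fun x hx a ha i _ => (F i).smul_mem_support (hx i trivial) ha)
    (fun x hx h0 => hK x (by
      have : K.mkQ x = 0 := hg (by simpa using h0)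
      simpa using this) fun i => hx i trivial)
    (by
      rw [finrank_coneProdSpan, Module.finrank_fin_fun]
      exact Finset.sum_congr rfl fun i _ => ((F i).mem_facets.1 (hσ i)).2)
  have hyU : y ∈ facetImage F f := by
    rw [facetImage_eq_univ hpos hbal f (Module.finrank_fin_fun ℝ) hσ hf]; trivial
  obtain ⟨ρ, hρ, -, q, hq, rfl⟩ := hyU
  refine hy ⟨q, fun i _ => ?_, rfl⟩
  simp only [support, Set.mem_iUnion]
  exact ⟨ρ i, ((F i).mem_facets.1 (hρ i)).1, hq i⟩

theorem finite_inter (F : Fin k → RationalFan n) : (inter F).Finite := by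
  refine ((Set.Finite.pi' fun i => (F i).cones.finite_toSet).image
    fun C : Fin k → RealCone n => ⨅ i, C i).subset ?_
  rintro D ⟨C, hC, rfl⟩
  exact ⟨C, hC, rfl⟩

end RationalFan

/-! ### Reduction to the diagonal -/

theorem mainTheorem6 (n k : ℕ) (F : Fin k → RationalFan n) (w : Fin k → RealCone n → ℝ)
    (hpos : ∀ i, ∀ σ ∈ (F i).facets, 0 < w i σ)
    (hbal : ∀ i, (F i).IsBalanced (w i)) :
    conesCodim (RationalFan.inter F) ≤ ∑ i, (F i).codim := by
  have hsum : ∑ i, (F i).codim = (k * n : ℕ) - ((∑ i, (F i).dim : ℕ) : ℤ) := by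
    simp [RationalFan.codim, conesCodim, RationalFan.dim, Finset.sum_sub_distrib]
  obtain ⟨K, hKdim, hK⟩ := Submodule.exists_disjoint_of_finrank_le
    ((RationalFan.finite_inter F).image RealCone.linearSpan)
    (e := conesDim (RationalFan.inter F))
    (by rintro _ ⟨D, hD, rfl⟩; exact dim_le_conesDim hD)
  rw [Module.finrank_fin_fun] at hKdim
  have hKmem : ∀ x ∈ K, (∀ i, x ∈ (F i).support) → x = 0 := by
    intro x hxK hx
    have : x ∈ ⋃ D ∈ RationalFan.inter F, (D : Set (Fin n → ℝ)) := by
      rw [RationalFan.iUnion_inter]; exact Set.mem_iInter.2 hx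
    simp only [Set.mem_iUnion] at this
    obtain ⟨D, hD, hxD⟩ := this
    exact Submodule.disjoint_def.1 (hK _ ⟨D, hD, rfl⟩) x hxK (D.subset_linearSpan hxD)
  let diag : (Fin n → ℝ) →ₗ[ℝ] (Fin k → Fin n → ℝ) := LinearMap.pi fun _ => LinearMap.id
  have hdiag : Function.Injective (diag.domRestrict K) := by
    rw [← LinearMap.ker_eq_bot, Submodule.eq_bot_iff]
    -- For `k = 0` the diagonal map is zero, but then `hKmem` holds without a support condition and
    -- forces `K = 0`.
    intro x hx
    have hx' : ∀ i : Fin k, (x : Fin n → ℝ) = 0 := fun i => congrFun (LinearMap.mem_ker.1 hx) i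
    refine Subtype.ext (hKmem x x.2 fun i => ?_)
    rw [hx' i]
    obtain ⟨C, hC⟩ := (F i).nonempty
    simp only [RationalFan.support, Set.mem_iUnion]
    exact ⟨C, hC, C.zero_mem⟩
  have hmain := RationalFan.finrank_add_sum_dim_le hpos hbal (K := K.map diag) (by
    rintro _ ⟨x, hx, rfl⟩ hmem
    rw [hKmem x hx hmem, map_zero])
  rw [← LinearMap.range_domRestrict, LinearMap.finrank_range_of_inj hdiag] at hmain
  rw [hsum, conesCodim]
  omega
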